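/- **Theorem.** Let $X$ be a topological space. An *ideal of closed subsets* of $X$ is a family of nonempty closed subsets of $X$ that is closed under binary unions, contains every singleton $\{x\}$ $(x\in X)$, and does not contain $X$ itself. Let $\mathcal A$ and $\mathcal B$ be ideals of closed subsets of $X$. Suppose that $X$ is $\mathcal A$-normal, i.e. whenever $A\in\mathcal A$, $U\subseteq X$ is open and $A\subseteq U$, there is an open $V$ with $A\subseteq V\subseteq \mathrm{cl}(V)\subseteq U$; and suppose that every member of $\mathcal B$ is sequentially compact. Then $$\mathsf G_1(\mathscr N_X[\mathcal A],\neg\Lambda_X(\mathcal B))\ \leq_{\mathrm{II}}\ \mathsf G_1(\mathscr T_{MU_{\mathcal A}(X)},\mathrm{CD}_{MU_{\mathcal B}(X)}),$$ and consequently $$\begin{aligned}\mathsf G_1(\mathscr N_X[\mathcal A],\neg\mathcal O_X(\mathcal B))&\equiv \mathsf G_1(\mathscr N_{MU_{\mathcal A}(X),\mathbf 0},\neg\Omega_{MU_{\mathcal B}(X),\mathbf 0})\\ &\equiv \mathsf G_1(\mathscr T_{MU_{\mathcal A}(X)},\neg\Omega_{MU_{\mathcal B}(X),\mathbf 0})\\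 &\equiv \mathsf G_1(\mathscr T_{MU_{\mathcal A}(X)},\mathrm{CD}_{MU_{\mathcal B}(X)}).\end{aligned}$$ Here the notation is as follows. *Games.* In $\mathsf G_1(\mathcal C,\mathcal D)$, in each round $n\in\omega$ player One chooses $C_n\in\mathcal C$ and player Two answers with $x_n\in C_n$; Two wins if $\{x_n:n\in\omega\}\in\mathcal D$, otherwise One wins. For a game $\mathcal G$, $\mathrm I\uparrow\mathcal G$ and $\mathrm{II}\uparrow\mathcal G$ mean that One, respectively Two, has a winning full-information strategy (depending on all previous moves of the opponent); $\mathrm I\underset{\mathrm{pre}}{\uparrow}\mathcal G$ means that One has a winning predetermined strategy (depending on the round number only); $\mathrm{II}\underset{\mathrm{mark}}{\uparrow}\mathcal G$ means that Two has a winning Markov strategy (depending on One's most recent move and the round number only). $\mathcal G\leq_{\mathrm{II}}\mathcal H$ means that each of the properties $\mathrm{II}\underset{\mathrm{mark}}{\uparrow}$, $\mathrm{II}\uparrow$, $\mathrm I\not\uparrow$, $\mathrm I\underset{\mathrm{pre}}{\not\uparrow}$ passes from $\mathcal G$ to $\mathcal H$; $\mathcal G\equiv\mathcal H$ means that each of these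 four properties holds for $\mathcal G$ if and only if it holds for $\mathcal H$. *Classes.* For a space $Y$, $\mathscr T_Y$ is the set of all proper nonempty open subsets of $Y$; $\mathscr N_{Y,y}=\{U\in\mathscr T_Y:y\in U\}$; $\Omega_{Y,y}$ is the set of all $S\subseteq Y$ with $y\in\mathrm{cl}(S)$; $\mathrm{CD}_Y$ is the set of all closed discrete subsets of $Y$. Further $\mathscr N_X[\mathcal A]=\{\mathscr N_X(A):A\in\mathcal A\}$ with $\mathscr N_X(A)=\{U\in\mathscr T_X:A\subseteq U\}$. $\mathcal O_X(\mathcal B)$ is the set of all open covers $\mathscr U$ of $X$ with $\emptyset,X\notin\mathscr U$ such that every $B\in\mathcal B$ is contained in some $U\in\mathscr U$; $\Lambda_X(\mathcal B)$ is the set of those $\mathscr U\in\mathcal O_X(\mathcal B)$ for which $\{U\in\mathscr U:B\subseteq U\}$ is infinite for every $B\in\mathcal B$. $\neg\mathcal D$ is the collection of sets not in $\mathcal D$. *Function spaces.* An *usco map* is a map $\Phi$ from $X$ to the nonempty compact subsets of $\mathbb R$ such that $\{x\in X:\Phi(x)\subseteq V\}$ is open for every open $V\subseteq\mathbb R$;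 it is *minimal* if its graph is minimal under inclusion among the graphs of usco maps. $MU(X)$ is the set of all minimal usco maps, $\mathbf 0\in MU(X)$ is the map with constant value $\{0\}$, and $MU_{\mathcal A}(X)$ is $MU(X)$ with the topology of the uniformity generated by the sets $$\mathbf W(A,\varepsilon)=\Big\{(\Phi,\Psi):\ \forall x\in A\ \ \Phi(x)\subseteq\bigcup_{y\in\Psi(x)}B(y,\varepsilon)\ \text{ and }\ \Psi(x)\subseteq\bigcup_{y\in\Phi(x)}B(y,\varepsilon)\Big\},\qquad A\in\mathcal A,\ \varepsilon>0;$$ similarly for $MU_{\mathcal B}(X)$. -/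

import Mathlib

open Set Filter Topology

/-! ### Selection games -/

/-- The single-selection game `G₁(moves, target)`: in round `n` player One chooses a set
`Aₙ ∈ moves`, player Two answers with a point `xₙ ∈ Aₙ`, and Two wins the run when
`{xₙ : n ∈ ℕ} ∈ target`. -/
structure SelectionGame (α : Type*) where
  moves : Set (Set α)
  target : Set (Set α)

namespace SelectionGame

/-- One has a winning (full-information) strategy: `σ` sends the finite sequence
`x₀, …, xₙ₋₁` of Two's previous answers to One's `n`-th move. -/
def OneWins {α : Type*} (G : SelectionGame α) : Prop :=
  ∃ σ : List ↥(⋃₀ G.moves) → ↥G.moves, ∀ x : ℕ → ↥(⋃₀ G.moves),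
    (∀ n, (x n : α) ∈ (σ ((List.range n).map x) : Set α)) →
      range (fun n => (x n : α)) ∉ G.target

/-- One has a winning predetermined strategy: One's `n`-th move depends on `n` only. -/
def OneWinsPre {α : Type*} (G : SelectionGame α) : Prop :=
  ∃ σ : ℕ → ↥G.moves, ∀ x : ℕ → α, (∀ n, x n ∈ (σ n : Set α)) → range x ∉ G.target

/-- Two has a winning (full-information) strategy: `τ` sends One's moves `A₀, …, Aₙ` to
Two's `n`-th answer, which has to be a point of `Aₙ`. -/
def TwoWins {α : Type*} (G : SelectionGame α) : Prop :=
  ∃ τ : List ↥G.moves → ↥(⋃₀ G.moves), ∀ A : ℕ → ↥G.moves,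
    (∀ n, (τ ((List.range (n + 1)).map A) : α) ∈ (A n : Set α)) ∧
      range (fun n => (τ ((List.range (n + 1)).map A) : α)) ∈ G.target

/-- Two has a winning Markov strategy: Two's `n`-th answer depends only on One's most recent
move `Aₙ`, of which it has to be a point, and on `n`. -/
def TwoWinsMark {α : Type*} (G : SelectionGame α) : Prop :=
  ∃ τ : ↥G.moves → ℕ → ↥(⋃₀ G.moves), ∀ A : ℕ → ↥G.moves,
    (∀ n, (τ (A n) n : α) ∈ (A n : Set α)) ∧
      range (fun n => (τ (A n) n : α)) ∈ G.target

/-- The preorder `G ≤_II H`. -/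
structure LeTwo {α β : Type*} (G : SelectionGame α) (H : SelectionGame β) : Prop where
  twoWinsMark : G.TwoWinsMark → H.TwoWinsMark
  twoWins : G.TwoWins → H.TwoWins
  not_oneWins : ¬ G.OneWins → ¬ H.OneWins
  not_oneWinsPre : ¬ G.OneWinsPre → ¬ H.OneWinsPre

/-- Equivalence of selection games. -/
structure Equivalent {α β : Type*} (G : SelectionGame α) (H : SelectionGame β) : Prop where
  twoWinsMark : G.TwoWinsMark ↔ H.TwoWinsMark
  twoWins : G.TwoWins ↔ H.TwoWins
  not_oneWins : ¬ G.OneWins ↔ ¬ H.OneWins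
  not_oneWinsPre : ¬ G.OneWinsPre ↔ ¬ H.OneWinsPre

end SelectionGame

/-! ### Ideals of closed sets and classes attached to a space

Two topologies on one and the same set occur together below, so the topology is an explicit
argument of the classes used for function spaces. -/

/-- Ideals of closed sets: families of nonempty closed sets, not containing the whole space,
that are closed under binary unions and contain all singletons. -/
structure IsClosedIdeal {X : Type*} [TopologicalSpace X] (𝒜 : Set (Set X)) : Prop where
  nonempty : ∀ A ∈ 𝒜, A.Nonempty
  isClosed : ∀ A ∈ 𝒜, IsClosed A
  union_mem : ∀ A ∈ 𝒜, ∀ B ∈ 𝒜, A ∪ B ∈ 𝒜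
  singleton_mem : ∀ x : X, {x} ∈ 𝒜
  univ_notMem : univ ∉ 𝒜

/-- `𝒜`-normality of a space. -/
def IsNormalFor {X : Type*} [TopologicalSpace X] (𝒜 : Set (Set X)) : Prop :=
  ∀ A ∈ 𝒜, ∀ U : Set X, IsOpen U → A ⊆ U →
    ∃ V : Set X, IsOpen V ∧ A ⊆ V ∧ closure V ⊆ U

/-- `𝒯`: the proper nonempty open sets. -/
def properOpens {Y : Type*} (t : TopologicalSpace Y) : Set (Set Y) :=
  {U | IsOpen[t] U ∧ U.Nonempty ∧ U ≠ univ}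

/-- `𝒩_y`: the proper open sets containing the point `y`. -/
def properNhds {Y : Type*} (t : TopologicalSpace Y) (y : Y) : Set (Set Y) :=
  {U | U ∈ properOpens t ∧ y ∈ U}

/-- `Ω_y`: the sets having `y` in their closure. -/
def clusterSets {Y : Type*} (t : TopologicalSpace Y) (y : Y) : Set (Set Y) :=
  {S | y ∈ @closure Y t S}

/-- `CD`: the closed discrete subsets. -/
def closedDiscrete {Y : Type*} (t : TopologicalSpace Y) : Set (Set Y) :=
  {S | IsClosed[t] S ∧ @IsDiscrete Y t S}

/-- `𝒩_X(A)`: the proper nonempty open sets containing the set `A`. -/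
def openSupersets {X : Type*} [t : TopologicalSpace X] (A : Set X) : Set (Set X) :=
  {U | U ∈ properOpens t ∧ A ⊆ U}

/-- `𝒩_X[𝒜] = {𝒩_X(A) : A ∈ 𝒜}`. -/
def openSupersetsFamily {X : Type*} [TopologicalSpace X] (𝒜 : Set (Set X)) :
    Set (Set (Set X)) :=
  openSupersets '' 𝒜

/-- `𝒪_X(𝒜)`: the `𝒜`-covers, that is, the open covers `𝒰` with `∅, X ∉ 𝒰` such that every
member of `𝒜` is contained in a member of `𝒰`. -/
def idealCovers {X : Type*} [TopologicalSpace X] (𝒜 : Set (Set X)) : Set (Set (Set X)) :=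
  {𝒰 | (∀ U ∈ 𝒰, IsOpen U) ∧ ⋃₀ 𝒰 = univ ∧ ∅ ∉ 𝒰 ∧ univ ∉ 𝒰 ∧ ∀ A ∈ 𝒜, ∃ U ∈ 𝒰, A ⊆ U}

/-- `Λ_X(𝒜)`: the `𝒜`-covers infinitely many members of which contain any given member
of `𝒜`. -/
def largeIdealCovers {X : Type*} [TopologicalSpace X] (𝒜 : Set (Set X)) :
    Set (Set (Set X)) :=
  {𝒰 | 𝒰 ∈ idealCovers 𝒜 ∧ ∀ A ∈ 𝒜, {U ∈ 𝒰 | A ⊆ U}.Infinite}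

/-! ### Minimal usco maps -/

/-- Usco maps: upper semicontinuous set-valued maps with nonempty compact values. -/
structure IsUsco {X Y : Type*} [TopologicalSpace X] [TopologicalSpace Y] (Φ : X → Set Y) :
    Prop where
  upperHemicontinuous : UpperHemicontinuous Φ
  nonempty : ∀ x, (Φ x).Nonempty
  isCompact : ∀ x, IsCompact (Φ x)

/-- `MU(X)`: the minimal usco maps from `X` to `ℝ`. The pointwise order on set-valued maps is
inclusion of graphs. -/
def MU (X : Type*) [TopologicalSpace X] : Type _ :=
  {Φ : X → Set ℝ // Minimal IsUsco Φ}

namespace MU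

/-- The map that is constantly `{0}`. -/
def zero (X : Type*) [TopologicalSpace X] : MU X :=
  ⟨fun _ => {0}, ⟨UpperHemicontinuous.const, fun _ => singleton_nonempty 0,
      fun _ => isCompact_singleton⟩, by
    intro Ψ hΨ hle x
    obtain ⟨y, hy⟩ := hΨ.nonempty x
    have h0 : y = 0 := hle x hy
    rintro _ rfl
    exact h0 ▸ hy⟩

/-- `W(A, ε)`: the pairs `(Φ, Ψ)` such that, for each `x ∈ A`, each of `Φ x` and `Ψ x` lies in
the open `ε`-neighbourhood of the other one. -/
def entourage {X : Type*} [TopologicalSpace X] (A : Set X) (ε : ℝ) : Set (MU X × MU X) :=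
  {p | ∀ x ∈ A, p.1.1 x ⊆ Metric.thickening ε (p.2.1 x) ∧
    p.2.1 x ⊆ Metric.thickening ε (p.1.1 x)}

/-- The uniformity on `MU(X)` generated by the sets `W(A, ε)` with `A ∈ 𝒜` and `ε > 0`. -/
def uniformCore {X : Type*} [TopologicalSpace X] (𝒜 : Set (Set X)) :
    UniformSpace.Core (MU X) where
  uniformity := ⨅ A ∈ 𝒜, ⨅ ε > (0 : ℝ), 𝓟 (entourage A ε)
  refl := by
    simp only [le_iInf_iff, le_principal_iff, mem_principal]
    rintro A - ε hε ⟨Φ, Ψ⟩ h x -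
    obtain rfl : Φ = Ψ := h
    exact ⟨Metric.self_subset_thickening hε _, Metric.self_subset_thickening hε _⟩
  symm := by
    simp only [tendsto_iInf, tendsto_principal]
    intro A hA ε hε
    refine mem_iInf_of_mem A (mem_iInf_of_mem hA (mem_iInf_of_mem ε (mem_iInf_of_mem hε ?_)))
    exact fun p hp x hx => (hp x hx).symm
  comp := by
    simp only [le_iInf_iff, le_principal_iff]
    intro A hA ε hε
    have hmem : entourage A (ε / 2) ∈ ⨅ A ∈ 𝒜, ⨅ ε > (0 : ℝ), 𝓟 (entourage A ε) :=
      mem_iInf_of_mem A (mem_iInf_of_mem hA (mem_iInf_of_mem (ε / 2)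
        (mem_iInf_of_mem (half_pos hε) (mem_principal_self _))))
    refine mem_of_superset (mem_lift' hmem) ?_
    have key : ∀ S : Set ℝ, Metric.thickening (ε / 2) (Metric.thickening (ε / 2) S) ⊆
        Metric.thickening ε S := fun S => by
      simpa using Metric.thickening_thickening_subset (ε / 2) (ε / 2) S
    rintro ⟨Φ, Ψ⟩ ⟨Θ, h₁, h₂⟩ x hx
    exact ⟨((h₁ x hx).1.trans (Metric.thickening_subset_of_subset _ (h₂ x hx).1)).trans (key _),
      ((h₂ x hx).2.trans (Metric.thickening_subset_of_subset _ (h₁ x hx).2)).trans (key _)⟩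

/-- The topology of `MU_𝒜(X)`, induced by that uniformity. -/
abbrev topology {X : Type*} [TopologicalSpace X] (𝒜 : Set (Set X)) : TopologicalSpace (MU X) :=
  (uniformCore 𝒜).toTopologicalSpace

end MU

/-! Five games (the covering game, its variant with large covers, and three games on minimal usco
maps) form a cycle for `LeTwo`, which gives all the equivalences. Each link is a round-by-round
translation of moves and answers that keeps Two winning.

The main link goes from large covers to closed discrete sets. Shrink One's open set in round `n` to
a basic neighbourhood `W(A, ε)[Φ]` and let Two answer `A` with an open `V ⊇ A`. By `𝒜`-normality
some minimal usco map equals `Φ` on `A` and `{n}` off `V`; Two plays it. If Two wins the covering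
run, some `B ∈ ℬ` lies in none of the sets `V`, so the `n`-th map takes the value `{n}` somewhere on
`B`. A usco map is bounded on the sequentially compact `B`, so its `W(B, 1)`-neighbourhood contains
only finitely many of these maps, and their range is closed and discrete.

The way back is softer: delete `𝟎` from One's moves, restrict One to neighbourhoods of `𝟎`, then
translate `A` in round `n` into `W(A, 1/(n+1))[𝟎]`. Upper semicontinuity spreads smallness on `A` to
an open `V ⊇ A`. Finitely many bad rounds never matter, since `B` can be enlarged by finitely many
points. -/

namespace SelectionGame

variable {α β γ : Type*}

theorem LeTwo.trans {G : SelectionGame α} {H : SelectionGame β} {K : SelectionGame γ}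
    (h₁ : G.LeTwo H) (h₂ : H.LeTwo K) : G.LeTwo K :=
  ⟨h₂.1 ∘ h₁.1, h₂.2 ∘ h₁.2, h₂.3 ∘ h₁.3, h₂.4 ∘ h₁.4⟩

theorem LeTwo.antisymm {G : SelectionGame α} {H : SelectionGame β}
    (h₁ : G.LeTwo H) (h₂ : H.LeTwo G) : G.Equivalent H :=
  ⟨⟨h₁.1, h₂.1⟩, ⟨h₁.2, h₂.2⟩, ⟨h₁.3, h₂.3⟩, ⟨h₁.4, h₂.4⟩⟩

/-! ### Transfer of strategies along translations -/

section Translation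

variable {G : SelectionGame α} {H : SelectionGame β}
  (f : ℕ → ↥H.moves → ↥G.moves) (g : ℕ → ↥H.moves → α → β)

/-- A round-by-round translation of One's moves in `H` into moves in `G`, and of Two's answers
in `G` back into answers in `H`, which preserves wins of Two. -/
structure IsTranslation : Prop where
  mem : ∀ n B, ∀ x ∈ (f n B : Set α), g n B x ∈ (B : Set β)
  target : ∀ (B : ℕ → ↥H.moves) (x : ℕ → α), (∀ n, x n ∈ (f n (B n) : Set α)) →
    range x ∈ G.target → range (fun n => g n (B n) (x n)) ∈ H.target

variable {f g}

theorem IsTranslation.twoWinsMark (h : IsTranslation f g) (hG : G.TwoWinsMark) :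
    H.TwoWinsMark := by
  obtain ⟨τ, hτ⟩ := hG
  have hmem : ∀ B n, (τ (f n B) n : α) ∈ (f n B : Set α) :=
    fun B n => (hτ fun _ => f n B).1 n
  refine ⟨fun B n => ⟨g n B (τ (f n B) n), B, B.2, h.mem _ _ _ (hmem B n)⟩, fun B =>
    ⟨fun n => h.mem _ _ _ (hmem _ n), ?_⟩⟩
  exact h.target B _ (fun n => hmem _ n) (hτ fun n => f n (B n)).2

theorem IsTranslation.twoWins (h : IsTranslation f g)
    (hne : G.moves.Nonempty → H.moves.Nonempty) (hG : G.TwoWins) : H.TwoWins := by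
  classical
  obtain ⟨τ, hτ⟩ := hG
  obtain ⟨B₀, hB₀⟩ : H.moves.Nonempty := by
    obtain ⟨A, hA, -⟩ := (τ []).2
    exact hne ⟨A, hA⟩
  let b₀ : H.moves := ⟨B₀, hB₀⟩
  have hb := h.mem 0 b₀ _ ((hτ fun _ => f 0 b₀).1 0)
  let d : ↥(⋃₀ H.moves) := ⟨_, B₀, hB₀, hb⟩
  -- The history already contains One's current move, so the round number is `L.length - 1`; `b₀` is
  -- read only on the empty history, which never occurs in a run.
  let ans : List ↥H.moves → β := fun L =>
    g (L.length - 1) (L.getLast?.getD b₀) (τ (L.mapIdx f))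
  have hans : ∀ (B : ℕ → ↥H.moves) n, ans ((List.range (n + 1)).map B) =
      g n (B n) (τ ((List.range (n + 1)).map fun i => f i (B i))) := by
    intro B n
    have : (((List.range (n + 1)).map B).mapIdx f) =
        (List.range (n + 1)).map fun i => f i (B i) := by
      apply List.ext_getElem <;> simp
    simp only [ans, this]
    simp [List.range_succ]
  have hmem : ∀ (B : ℕ → ↥H.moves) n, ans ((List.range (n + 1)).map B) ∈ (B n : Set β) := by
    intro B n
    rw [hans]
    exact h.mem _ _ _ ((hτ fun i => f i (B i)).1 n)
  refine ⟨fun L => if hL : ans L ∈ ⋃₀ H.moves then ⟨ans L, hL⟩ else d, fun B => ?_⟩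
  have hval : ∀ n, ((if hL : ans ((List.range (n + 1)).map B) ∈ ⋃₀ H.moves then ⟨_, hL⟩ else d :
      ↥(⋃₀ H.moves)) : β) = ans ((List.range (n + 1)).map B) := by
    intro n
    rw [dif_pos ⟨B n, (B n).2, hmem B n⟩]
  simp only [hval]
  refine ⟨hmem B, ?_⟩
  simp only [hans]
  exact h.target B _ (hτ fun i => f i (B i)).1 (hτ fun i => f i (B i)).2

theorem IsTranslation.oneWins (h : IsTranslation f g)
    (hne : ∀ B ∈ H.moves, B.Nonempty) (hH : H.OneWins) : G.OneWins := by
  classical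
  obtain ⟨σ, hσ⟩ := hH
  obtain ⟨b, hb⟩ := hne _ (σ []).2
  let d : ↥(⋃₀ H.moves) := ⟨b, _, (σ []).2, hb⟩
  let conv : ℕ → ↥H.moves → ↥(⋃₀ G.moves) → ↥(⋃₀ H.moves) := fun n B x =>
    if hx : g n B x ∈ (B : Set β) then ⟨g n B x, B, B.2, hx⟩ else d
  -- Translating an answer requires One's move in `H`, which depends on earlier translated answers;
  -- hence the run of `H` is rebuilt from the left.
  let hist : List ↥(⋃₀ G.moves) → List ↥(⋃₀ H.moves) := fun l =>
    l.foldl (fun L x => L ++ [conv L.length (σ L) x]) []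
  refine ⟨fun l => f l.length (σ (hist l)), fun x hx hwin => ?_⟩
  let y : ℕ → ↥(⋃₀ H.moves) := fun n => conv n (σ (hist ((List.range n).map x))) (x n)
  have hist_eq : ∀ n, hist ((List.range n).map x) = (List.range n).map y := by
    intro n
    induction n with
    | zero => simp [hist]
    | succ n ih =>
      have : hist ((List.range (n + 1)).map x) = hist ((List.range n).map x) ++
          [conv (hist ((List.range n).map x)).length (σ (hist ((List.range n).map x))) (x n)] := by
        simp [hist, List.range_succ]
      rw [this]
      have hl : (hist ((List.range n).map x)).length = n := by simp [ih]
      rw [hl, List.range_succ, List.map_append, ← ih]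
      rfl
  simp only [List.length_map, List.length_range, hist_eq] at hx
  have hy : ∀ n, (y n : β) = g n (σ ((List.range n).map y)) (x n) := by
    intro n
    change (conv n (σ (hist ((List.range n).map x))) (x n) : β) = _
    rw [hist_eq]
    simp only [conv, dif_pos (h.mem _ _ _ (hx n))]
  refine hσ y (fun n => ?_) ?_
  · rw [hy]
    exact h.mem _ _ _ (hx n)
  · simp only [hy]
    exact h.target (fun n => σ ((List.range n).map y)) _ hx hwin

theorem IsTranslation.oneWinsPre (h : IsTranslation f g) (hH : H.OneWinsPre) :
    G.OneWinsPre := by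
  obtain ⟨σ, hσ⟩ := hH
  exact ⟨fun n => f n (σ n), fun x hx hwin =>
    hσ _ (fun n => h.mem _ _ _ (hx n)) (h.target σ x hx hwin)⟩

theorem IsTranslation.leTwo (h : IsTranslation f g)
    (hmoves : G.moves.Nonempty → H.moves.Nonempty) (hne : ∀ B ∈ H.moves, B.Nonempty) :
    G.LeTwo H :=
  ⟨h.twoWinsMark, h.twoWins hmoves, mt (h.oneWins hne), mt h.oneWinsPre⟩

end Translation

end SelectionGame

/-! ### Existence, modification and boundedness of usco maps -/

section Usco

variable {X : Type*} [TopologicalSpace X]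

theorem IsUsco.eventually_subset {Y : Type*} [TopologicalSpace Y] {Φ : X → Set Y} (h : IsUsco Φ)
    {x : X} {u : Set Y} (hu : IsOpen u) (hx : Φ x ⊆ u) : ∀ᶠ x' in 𝓝 x, Φ x' ⊆ u :=
  h.upperHemicontinuous.forall_isOpen x u hu hx

theorem IsUsco.of_forall_isOpen {Y : Type*} [TopologicalSpace Y] {Φ : X → Set Y}
    (h : ∀ x u, IsOpen u → Φ x ⊆ u → ∀ᶠ x' in 𝓝 x, Φ x' ⊆ u)
    (hne : ∀ x, (Φ x).Nonempty) (hc : ∀ x, IsCompact (Φ x)) : IsUsco Φ :=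
  ⟨.of_forall_isOpen h, hne, hc⟩

/-- Every usco map into a Hausdorff space contains a minimal one. -/
theorem IsUsco.exists_minimal_le {Y : Type*} [TopologicalSpace Y] [T2Space Y] {Φ : X → Set Y}
    (hΦ : IsUsco Φ) : ∃ Ψ, Ψ ≤ Φ ∧ Minimal IsUsco Ψ := by
  refine @zorn_le_nonempty₀ (X → Set Y)ᵒᵈ _ {Ψ | IsUsco Ψ} (fun c hcs hc Ψ₀ hΨ₀ => ?_) Φ hΦ
  have : Nonempty c := ⟨⟨Ψ₀, hΨ₀⟩⟩
  let F : c → X → Set Y := fun Ψ => Ψ.1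
  have hF : ∀ i, IsUsco (F i) := fun i => hcs i.2
  have hdir : ∀ x, Directed (· ⊇ ·) fun i => F i x := by
    intro x i j
    rcases hc.total i.2 j.2 with h | h
    · exact ⟨j, h x, Subset.rfl⟩
    · exact ⟨i, Subset.rfl, h x⟩
  refine ⟨fun x => ⋂ i, F i x, IsUsco.of_forall_isOpen ?_ ?_ ?_, fun Ψ hΨ x => ?_⟩
  · intro x u hu hx
    -- By compactness a single member of the chain already has its value at `x` inside `u`.
    obtain ⟨i, hi⟩ := exists_subset_nhds_of_isCompact (hdir x) (fun i => (hF i).isCompact x)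
      (fun y hy => hu.mem_nhds (hx hy))
    filter_upwards [(hF i).eventually_subset hu hi] with x' hx'
    exact (iInter_subset _ i).trans hx'
  · exact fun x => IsCompact.nonempty_iInter_of_directed_nonempty_isCompact_isClosed _ (hdir x)
      (fun i => (hF i).nonempty x) (fun i => (hF i).isCompact x)
      fun i => ((hF i).isCompact x).isClosed
  · exact fun x => ((hF ⟨Ψ₀, hΨ₀⟩).isCompact x).of_isClosed_subset
      (isClosed_iInter fun i => ((hF i).isCompact x).isClosed) (iInter_subset _ _)
  · exact iInter_subset (fun i => F i x) ⟨Ψ, hΨ⟩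

/-- Replacing a minimal usco map outside the closure of an open set by a constant. -/
theorem IsUsco.exists_minimal_eqOn {Y : Type*} [TopologicalSpace Y] [T2Space Y] {Φ : X → Set Y}
    (hΦ : Minimal IsUsco Φ) {W : Set X} (hW : IsOpen W) (c : Y) :
    ∃ Ψ, Minimal IsUsco Ψ ∧ EqOn Ψ Φ W ∧ ∀ x ∉ closure W, Ψ x = {c} := by
  classical
  -- On the frontier of `W` both kinds of values are needed for upper semicontinuity.
  let Θ : X → Set Y := fun x =>
    if x ∈ W then Φ x else if x ∈ closure W then Φ x ∪ {c} else {c}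
  have hΘW : ∀ x ∈ W, Θ x = Φ x := fun x hx => if_pos hx
  have hΘc : ∀ x ∉ closure W, Θ x = {c} := fun x hx => by
    have hx' : x ∉ W := fun h => hx (subset_closure h)
    simp [Θ, hx, hx']
  have hΘb : ∀ x ∉ W, x ∈ closure W → Θ x = Φ x ∪ {c} := fun x hx hx' => by simp [Θ, hx, hx']
  have hΘle : ∀ x, Θ x ⊆ Φ x ∪ {c} := fun x => by
    simp only [Θ]
    split_ifs <;> simp
  have hΘ : IsUsco Θ := by
    refine .of_forall_isOpen (fun x u hu hx => ?_) (fun x => ?_) (fun x => ?_)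
    · by_cases h₁ : x ∈ W
      · rw [hΘW x h₁] at hx
        filter_upwards [hΦ.prop.eventually_subset hu hx, hW.mem_nhds h₁] with x' h h'
        rwa [hΘW x' h']
      by_cases h₂ : x ∈ closure W
      · rw [hΘb x h₁ h₂, union_subset_iff] at hx
        filter_upwards [hΦ.prop.eventually_subset hu hx.1] with x' h
        exact (hΘle x').trans (union_subset h hx.2)
      · rw [hΘc x h₂] at hx
        filter_upwards [isClosed_closure.isOpen_compl.mem_nhds h₂] with x' h'
        rwa [hΘc x' h']
    · simp only [Θ]
      split_ifs
      exacts [hΦ.prop.nonempty x, (hΦ.prop.nonempty x).inl, singleton_nonempty c]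
    · simp only [Θ]
      split_ifs
      exacts [hΦ.prop.isCompact x, (hΦ.prop.isCompact x).union isCompact_singleton,
        isCompact_singleton]
  obtain ⟨Ψ, hΨle, hΨ⟩ := hΘ.exists_minimal_le
  have hΨW : ∀ x ∈ W, Ψ x ⊆ Φ x := fun x hx => (hΨle x).trans (hΘW x hx).le
  refine ⟨Ψ, hΨ, fun x hx => (hΨW x hx).antisymm ?_, fun x hx => ?_⟩
  -- The glued map is usco and below `Φ`, so minimality of `Φ` forces equality on `W`.
  · let Ξ : X → Set Y := fun x => if x ∈ W then Ψ x else Φ x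
    have hΞle : Ξ ≤ Φ := fun x => by
      by_cases h : x ∈ W
      · simpa [Ξ, h] using hΨW x h
      · simp [Ξ, h]
    have hΞ : IsUsco Ξ := by
      refine .of_forall_isOpen (fun x u hu hx => ?_) (fun x => ?_) (fun x => ?_)
      · by_cases h : x ∈ W
        · simp only [Ξ, h, if_true] at hx
          filter_upwards [hΨ.prop.eventually_subset hu hx, hW.mem_nhds h] with x' h₁ h₂
          simpa [Ξ, h₂] using h₁
        · simp only [Ξ, h, if_false] at hx
          filter_upwards [hΦ.prop.eventually_subset hu hx] with x' h₁
          exact (hΞle x').trans h₁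
      · simp only [Ξ]
        split_ifs
        exacts [hΨ.prop.nonempty x, hΦ.prop.nonempty x]
      · simp only [Ξ]
        split_ifs
        exacts [hΨ.prop.isCompact x, hΦ.prop.isCompact x]
    simpa [Ξ, hx] using hΦ.le_of_le hΞ hΞle x
  · exact ((hΨ.prop.nonempty x).subset_singleton_iff).1 ((hΨle x).trans (hΘc x hx).le)

/-- An usco map into `ℝ` is bounded on sequentially compact sets. -/
theorem IsUsco.exists_forall_abs_lt {Φ : X → Set ℝ} (hΦ : IsUsco Φ) {B : Set X}
    (hB : IsSeqCompact B) : ∃ M : ℕ, ∀ x ∈ B, ∀ y ∈ Φ x, |y| < M := by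
  by_contra! h
  choose x hx y hy hxy using h
  -- Near the limit `a` the values stay in one ball, while those at `x (φ n)` reach size at least `φ
  -- n ≥ n`.
  obtain ⟨a, -, φ, hφ, hlim⟩ := hB hx
  obtain ⟨r, hr⟩ := (hΦ.isCompact a).isBounded.subset_ball 0
  have h₁ := hlim.eventually (hΦ.eventually_subset Metric.isOpen_ball hr)
  obtain ⟨n, hn, hn'⟩ := (h₁.and (eventually_ge_atTop ⌈r⌉₊)).exists
  have h₂ := hn (hy (φ n))
  rw [mem_ball_zero_iff, Real.norm_eq_abs] at h₂
  have h₃ : (n : ℝ) ≤ φ n := by exact_mod_cast hφ.id_le n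
  have := Nat.ceil_le.1 hn'
  linarith [hxy (φ n)]

end Usco

/-! ### The topology of `MU_𝒜(X)` -/

namespace MU

variable {X : Type*} [TopologicalSpace X]

/-- The minimal usco map with constant value `{c}`. -/
def const (X : Type*) [TopologicalSpace X] (c : ℝ) : MU X :=
  ⟨fun _ => {c}, ⟨UpperHemicontinuous.const, fun _ => singleton_nonempty c,
      fun _ => isCompact_singleton⟩, fun _ hΨ hle x =>
    (((hΨ.nonempty x).subset_singleton_iff).1 (hle x)).ge⟩

theorem entourage_mono {A A' : Set X} {ε ε' : ℝ} (hA : A ⊆ A') (hε : ε' ≤ ε) :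
    entourage A' ε' ⊆ entourage A ε := fun _ hp x hx =>
  ⟨(hp x (hA hx)).1.trans (Metric.thickening_mono hε _),
    (hp x (hA hx)).2.trans (Metric.thickening_mono hε _)⟩

/-- Binary unions make the generating entourages directed; a singleton shows that there is at least
one. -/
theorem hasBasis_nhds [Nonempty X] {𝒜 : Set (Set X)} (h𝒜 : IsClosedIdeal 𝒜) (Φ : MU X) :
    (@nhds _ (topology 𝒜) Φ).HasBasis (fun p : Set X × ℝ => p.1 ∈ 𝒜 ∧ 0 < p.2)
      fun p => {Ψ | (Φ, Ψ) ∈ entourage p.1 p.2} := by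
  rw [UniformSpace.Core.nhds_toTopologicalSpace]
  refine HasBasis.comap _ (p := fun p : Set X × ℝ => p.1 ∈ 𝒜 ∧ 0 < p.2)
    (s := fun p => entourage p.1 p.2) ?_
  have : (uniformCore 𝒜).uniformity =
      ⨅ p ∈ {p : Set X × ℝ | p.1 ∈ 𝒜 ∧ 0 < p.2}, 𝓟 (entourage p.1 p.2) := by
    simp only [uniformCore, iInf_prod, mem_ofPred_eq, iInf_and]
    refine iInf_congr fun A => ?_
    rw [iInf_comm]
  rw [this]
  refine hasBasis_biInf_principal ?_ ?_
  · rintro ⟨A, ε⟩ ⟨hA, hε⟩ ⟨A', ε'⟩ ⟨hA', hε'⟩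
    exact ⟨(A ∪ A', min ε ε'), ⟨h𝒜.union_mem _ hA _ hA', lt_min hε hε'⟩,
      entourage_mono subset_union_left (min_le_left _ _),
      entourage_mono subset_union_right (min_le_right _ _)⟩
  · exact ⟨({Classical.arbitrary X}, 1), h𝒜.singleton_mem _, one_pos⟩

theorem entourage_mem_nhds [Nonempty X] {𝒜 : Set (Set X)} (h𝒜 : IsClosedIdeal 𝒜) (Φ : MU X)
    {A : Set X} (hA : A ∈ 𝒜) {ε : ℝ} (hε : 0 < ε) :
    {Ψ | (Φ, Ψ) ∈ entourage A ε} ∈ @nhds _ (topology 𝒜) Φ :=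
  (hasBasis_nhds h𝒜 Φ).mem_of_mem (i := (A, ε)) ⟨hA, hε⟩

/-- Compact values are closed, hence equal to the intersection of their thickenings. -/
theorem exists_notMem_entourage {Φ Ψ : MU X} (h : Φ ≠ Ψ) :
    ∃ x, ∃ ε > 0, (Φ, Ψ) ∉ entourage {x} ε := by
  have hsep : ∀ {S T : Set ℝ}, IsCompact T → (∀ ε > 0, S ⊆ Metric.thickening ε T) → S ⊆ T := by
    intro S T hT hST
    have : S ⊆ ⋂ ε > 0, Metric.thickening ε T := subset_iInter₂ hST
    rwa [← Metric.closure_eq_iInter_thickening, hT.isClosed.closure_eq] at this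
  contrapose! h
  refine Subtype.ext (funext fun x => ?_)
  exact (hsep (Ψ.2.prop.isCompact x) fun ε hε => (h x ε hε x rfl).1).antisymm
    (hsep (Φ.2.prop.isCompact x) fun ε hε => (h x ε hε x rfl).2)

theorem t1Space [Nonempty X] {𝒜 : Set (Set X)} (h𝒜 : IsClosedIdeal 𝒜) :
    @T1Space (MU X) (topology 𝒜) := by
  let _ := topology 𝒜
  refine ⟨fun Ψ => ⟨isOpen_iff_mem_nhds.2 fun Φ (hΦ : Φ ≠ Ψ) => ?_⟩⟩
  obtain ⟨x, ε, hε, h⟩ := exists_notMem_entourage hΦ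
  filter_upwards [entourage_mem_nhds h𝒜 Φ (h𝒜.singleton_mem x) hε]
  rintro Θ hΘ rfl
  exact h hΘ

theorem const_mem_entourage_zero {A : Set X} {ε c : ℝ} (hc : |c| < ε) :
    (zero X, const X c) ∈ entourage A ε := by
  intro x _
  simp [zero, const, Real.dist_eq, hc]

theorem subset_ball_of_mem_entourage_zero {A : Set X} {ε : ℝ} {Φ : MU X}
    (h : (zero X, Φ) ∈ entourage A ε) {x : X} (hx : x ∈ A) : Φ.1 x ⊆ Metric.ball 0 ε := by
  simpa [zero] using (h x hx).2

theorem mem_entourage_zero {A : Set X} {ε : ℝ} {Φ : MU X}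
    (h : ∀ x ∈ A, Φ.1 x ⊆ Metric.ball 0 ε) : (zero X, Φ) ∈ entourage A ε := by
  intro x hx
  refine ⟨?_, by simpa [zero] using h x hx⟩
  obtain ⟨y, hy⟩ := Φ.2.prop.nonempty x
  rintro _ rfl
  exact Metric.mem_thickening_iff.2 ⟨y, hy, by simpa [dist_comm] using h x hx hy⟩

theorem nonempty_of_properOpens {𝒜 : Set (Set X)} (h : (properOpens (topology 𝒜)).Nonempty) :
    Nonempty X := by
  by_contra hX
  rw [not_nonempty_iff] at hX
  have : Subsingleton (MU X) := ⟨fun Φ Ψ => Subtype.ext (funext isEmptyElim)⟩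
  obtain ⟨U, -, hU, hU'⟩ := h
  exact hU' hU.eq_univ

end MU

/-- Each point has a neighbourhood meeting the range in a finite set, and `T1` allows removing the
finitely many points other than the centre. -/
theorem isClosed_and_isDiscrete_range {Y : Type*} [TopologicalSpace Y] [T1Space Y] {u : ℕ → Y}
    (h : ∀ y, ∃ N ∈ 𝓝 y, {n | u n ∈ N}.Finite) : IsClosed (range u) ∧ IsDiscrete (range u) := by
  rw [isClosed_and_discrete_iff]
  intro y
  obtain ⟨N, hN, hfin⟩ := h y
  rw [disjoint_principal_right, mem_nhdsWithin_iff_eventually]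
  have hF : (u '' {n | u n ∈ N} \ {y})ᶜ ∈ 𝓝 y :=
    ((hfin.image u).subset sdiff_subset).isClosed.isOpen_compl.mem_nhds (by simp)
  filter_upwards [hN, hF] with z hz hz' hzy
  rintro ⟨n, rfl⟩
  exact hz' ⟨⟨n, hz, rfl⟩, hzy⟩

/-! ### Ideals and failure of covering -/

namespace IsClosedIdeal

variable {X : Type*} [TopologicalSpace X] {𝒜 : Set (Set X)}

theorem union_finite_mem (h : IsClosedIdeal 𝒜) {B : Set X} (hB : B ∈ 𝒜) {F : Set X}
    (hF : F.Finite) : B ∪ F ∈ 𝒜 := by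
  induction F, hF using Set.Finite.induction_on with
  | empty => simpa using hB
  | insert _ _ ih =>
    rw [insert_eq, union_left_comm]
    exact h.union_mem _ (h.singleton_mem _) _ ih

theorem openSupersets_nonempty (h : IsClosedIdeal 𝒜) {A : Set X} (hA : A ∈ 𝒜) :
    (openSupersets A).Nonempty := by
  obtain ⟨p, hp⟩ : ∃ p, p ∉ A := by
    by_contra! hall
    exact h.univ_notMem (eq_univ_of_forall hall ▸ hA)
  have hsub : A ⊆ {p}ᶜ := fun x hx hxp => hp (hxp ▸ hx)
  exact ⟨{p}ᶜ, ⟨(h.isClosed _ (h.singleton_mem p)).isOpen_compl, (h.nonempty A hA).mono hsub,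
    fun hu => (hu ▸ mem_univ p : p ∈ ({p}ᶜ : Set X)) rfl⟩, hsub⟩

theorem nonempty_of_openSupersetsFamily (h : IsClosedIdeal 𝒜)
    (hne : (openSupersetsFamily 𝒜).Nonempty) : Nonempty X := by
  obtain ⟨_, A, hA, -⟩ := hne
  exact (h.nonempty A hA).to_type

theorem openSupersetsFamily_nonempty [Nonempty X] (h : IsClosedIdeal 𝒜) :
    (openSupersetsFamily 𝒜).Nonempty :=
  ⟨_, _, h.singleton_mem (Classical.arbitrary X), rfl⟩

/-- Adding finitely many points to a member of the ideal makes it escape any given finite set of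
proper subsets. -/
theorem exists_superset_not_subset (h : IsClosedIdeal 𝒜) {B : Set X} (hB : B ∈ 𝒜)
    {𝒱 : Set (Set X)} (hfin : 𝒱.Finite) (hproper : ∀ V ∈ 𝒱, V ≠ univ) :
    ∃ B' ∈ 𝒜, B ⊆ B' ∧ ∀ V ∈ 𝒱, ¬ B' ⊆ V := by
  have : ∀ V, ∃ p, V ∈ 𝒱 → p ∉ V := by
    intro V
    by_cases hV : V ∈ 𝒱
    · obtain ⟨p, hp⟩ := (ne_univ_iff_exists_notMem V).1 (hproper V hV)
      exact ⟨p, fun _ => hp⟩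
    · exact ⟨(h.nonempty B hB).some, fun h => absurd h hV⟩
  choose p hp using this
  exact ⟨B ∪ p '' 𝒱, h.union_finite_mem hB (hfin.image p), subset_union_left,
    fun V hV hsub => hp V hV (hsub (Or.inr ⟨V, hV, rfl⟩))⟩

theorem notMem_idealCovers_iff [Nonempty X] (h : IsClosedIdeal 𝒜) {𝒱 : Set (Set X)}
    (h𝒱 : ∀ V ∈ 𝒱, V ∈ properOpens ‹TopologicalSpace X›) :
    𝒱 ∉ idealCovers 𝒜 ↔ ∃ B ∈ 𝒜, ∀ V ∈ 𝒱, ¬ B ⊆ V := by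
  constructor
  · intro hn
    contrapose! hn
    refine ⟨fun V hV => (h𝒱 V hV).1, eq_univ_of_forall fun x => ?_,
      fun he => not_nonempty_empty (h𝒱 _ he).2.1, fun hu => (h𝒱 _ hu).2.2 rfl, hn⟩
    obtain ⟨V, hV, hxV⟩ := hn _ (h.singleton_mem x)
    exact ⟨V, hV, hxV rfl⟩
  · rintro ⟨B, hB, hn⟩ ⟨-, -, -, -, hcov⟩
    obtain ⟨V, hV, hBV⟩ := hcov B hB
    exact hn V hV hBV

/-- If only finitely many members contain `B`, finitely many extra points make `B` escape those as
well. So failing to be a large cover is no weaker than failing to be a cover. -/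
theorem exists_not_subset_of_notMem_largeIdealCovers [Nonempty X] (h : IsClosedIdeal 𝒜)
    {𝒱 : Set (Set X)} (h𝒱 : ∀ V ∈ 𝒱, V ∈ properOpens ‹TopologicalSpace X›)
    (hn : 𝒱 ∉ largeIdealCovers 𝒜) : ∃ B ∈ 𝒜, ∀ V ∈ 𝒱, ¬ B ⊆ V := by
  by_cases hc : 𝒱 ∈ idealCovers 𝒜
  · obtain ⟨B, hB, hfin⟩ : ∃ B ∈ 𝒜, {V ∈ 𝒱 | B ⊆ V}.Finite := by
      by_contra! hinf
      exact hn ⟨hc, hinf⟩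
    obtain ⟨B', hB', hBB', hB''⟩ := h.exists_superset_not_subset hB hfin
      fun V hV => (h𝒱 V hV.1).2.2
    exact ⟨B', hB', fun V hV hsub => hB'' V ⟨hV, hBB'.trans hsub⟩ hsub⟩
  · exact (h.notMem_idealCovers_iff h𝒱).1 hc

end IsClosedIdeal

/-! ### The cycle of games -/

section Games

open MU

variable {X : Type*} [TopologicalSpace X] {𝒜 ℬ : Set (Set X)}

/-- The game `G₁(𝒩_X[𝒜], ¬𝒪_X(ℬ))`. -/
def coverGame (𝒜 ℬ : Set (Set X)) : SelectionGame (Set X) :=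
  ⟨openSupersetsFamily 𝒜, (idealCovers ℬ)ᶜ⟩

/-- The game `G₁(𝒩_X[𝒜], ¬Λ_X(ℬ))`. -/
def largeCoverGame (𝒜 ℬ : Set (Set X)) : SelectionGame (Set X) :=
  ⟨openSupersetsFamily 𝒜, (largeIdealCovers ℬ)ᶜ⟩

/-- The game `G₁(𝒩_𝟎, ¬Ω_𝟎)` on `MU(X)`. -/
def nhdsZeroGame (𝒜 ℬ : Set (Set X)) : SelectionGame (MU X) :=
  ⟨properNhds (topology 𝒜) (zero X), (clusterSets (topology ℬ) (zero X))ᶜ⟩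

/-- The game `G₁(𝒯, ¬Ω_𝟎)` on `MU(X)`. -/
def opensZeroGame (𝒜 ℬ : Set (Set X)) : SelectionGame (MU X) :=
  ⟨properOpens (topology 𝒜), (clusterSets (topology ℬ) (zero X))ᶜ⟩

/-- The game `G₁(𝒯, CD)` on `MU(X)`. -/
def closedDiscreteGame (𝒜 ℬ : Set (Set X)) : SelectionGame (MU X) :=
  ⟨properOpens (topology 𝒜), closedDiscrete (topology ℬ)⟩

theorem openSupersetsFamily_member_nonempty (h𝒜 : IsClosedIdeal 𝒜) :
    ∀ N ∈ openSupersetsFamily 𝒜, N.Nonempty := by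
  rintro _ ⟨A, hA, rfl⟩
  exact h𝒜.openSupersets_nonempty hA

/-- The interior of the `ε`-neighbourhood `W(A, ε)[𝟎]`. -/
def zeroNhd (𝒜 : Set (Set X)) (A : Set X) (ε : ℝ) : Set (MU X) :=
  @interior _ (topology 𝒜) {Φ | (zero X, Φ) ∈ entourage A ε}

theorem mem_entourage_of_mem_zeroNhd {A : Set X} {ε : ℝ} {Φ : MU X} (h : Φ ∈ zeroNhd 𝒜 A ε) :
    (zero X, Φ) ∈ entourage A ε :=
  (@interior_subset _ (topology 𝒜) {Φ | (zero X, Φ) ∈ entourage A ε}) h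

theorem zeroNhd_mem_properNhds (h𝒜 : IsClosedIdeal 𝒜) {A : Set X} (hA : A ∈ 𝒜) {ε : ℝ}
    (hε : 0 < ε) : zeroNhd 𝒜 A ε ∈ properNhds (topology 𝒜) (zero X) := by
  let _ := topology 𝒜
  have : Nonempty X := (h𝒜.nonempty A hA).to_type
  have h0 : zero X ∈ zeroNhd 𝒜 A ε :=
    mem_interior_iff_mem_nhds.2 (entourage_mem_nhds h𝒜 _ hA hε)
  refine ⟨⟨isOpen_interior, ⟨_, h0⟩, fun hu => ?_⟩, h0⟩
  -- The constant `ε` just misses the open `ε`-ball, so it witnesses properness.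
  have hmem : MU.const X ε ∈ zeroNhd 𝒜 A ε := hu ▸ mem_univ _
  obtain ⟨x, hx⟩ := h𝒜.nonempty A hA
  have := subset_ball_of_mem_entourage_zero (mem_entourage_of_mem_zeroNhd hmem) hx (mem_singleton ε)
  simp [abs_of_pos hε] at this

theorem properNhds_zero_nonempty [Nonempty X] (h𝒜 : IsClosedIdeal 𝒜) :
    (properNhds (topology 𝒜) (zero X)).Nonempty :=
  ⟨_, zeroNhd_mem_properNhds h𝒜 (h𝒜.singleton_mem (Classical.arbitrary X)) one_pos⟩

theorem properOpens_topology_nonempty [Nonempty X] (h𝒜 : IsClosedIdeal 𝒜) :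
    (properOpens (topology 𝒜)).Nonempty :=
  (properNhds_zero_nonempty h𝒜).mono fun _ h => h.1

theorem coverGame_leTwo_largeCoverGame (h𝒜 : IsClosedIdeal 𝒜) :
    (coverGame 𝒜 ℬ).LeTwo (largeCoverGame 𝒜 ℬ) := by
  refine SelectionGame.IsTranslation.leTwo (G := coverGame 𝒜 ℬ) (H := largeCoverGame 𝒜 ℬ)
    (f := fun _ N => N) (g := fun _ _ V => V) ⟨fun _ _ _ hV => hV, ?_⟩ id
    (openSupersetsFamily_member_nonempty h𝒜)
  exact fun _ _ _ hc hl => hc hl.1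

/-- Some minimal usco map agrees with `Φ` on `A` and has the value `{c}` off `V`. -/
theorem exists_MU_eqOn (hnormal : IsNormalFor 𝒜) (Φ : MU X) {A V : Set X} (hA : A ∈ 𝒜)
    (hV : IsOpen V) (hAV : A ⊆ V) (c : ℝ) :
    ∃ Ψ : MU X, EqOn Ψ.1 Φ.1 A ∧ ∀ x ∉ V, Ψ.1 x = {c} := by
  obtain ⟨W, hW, hAW, hWV⟩ := hnormal A hA V hV hAV
  obtain ⟨Ψ, hΨ, hΨW, hΨc⟩ := IsUsco.exists_minimal_eqOn Φ.2 hW c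
  exact ⟨⟨Ψ, hΨ⟩, hΨW.mono hAW, fun x hx => hΨc x fun h => hx (hWV h)⟩

theorem closedDiscrete_range_of_not_subset (hℬ : IsClosedIdeal ℬ)
    {B : Set X} (hB : B ∈ ℬ) (hseq : IsSeqCompact B) {V : ℕ → Set X} (hBV : ∀ n, ¬ B ⊆ V n)
    {Φ : ℕ → MU X} (hΦ : ∀ n, ∀ x ∉ V n, (Φ n).1 x = {(n : ℝ)}) :
    range Φ ∈ closedDiscrete (topology ℬ) := by
  let _ := topology ℬ
  have : Nonempty X := (hℬ.nonempty B hB).to_type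
  have : T1Space (MU X) := t1Space hℬ
  refine isClosed_and_isDiscrete_range fun Ψ => ⟨_, entourage_mem_nhds hℬ Ψ hB one_pos, ?_⟩
  obtain ⟨M, hM⟩ := Ψ.2.prop.exists_forall_abs_lt hseq
  -- A map within `1` of `Ψ` on `B` takes values below `M + 1` there, which bounds `n`.
  refine (finite_Iic (M + 1)).subset fun n hn => ?_
  obtain ⟨x, hxB, hxV⟩ := not_subset.1 (hBV n)
  have h := (hn x hxB).2
  simp only [hΦ n x hxV, singleton_subset_iff, Metric.mem_thickening_iff] at h
  obtain ⟨y, hy, hdist⟩ := h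
  have h₁ := hM x hxB y hy
  rw [Real.dist_eq] at hdist
  have : (n : ℝ) ≤ M + 1 := by linarith [(abs_lt.1 h₁).2, (abs_lt.1 hdist).2]
  exact_mod_cast this

theorem largeCoverGame_leTwo_closedDiscreteGame (h𝒜 : IsClosedIdeal 𝒜) (hℬ : IsClosedIdeal ℬ)
    (hnormal : IsNormalFor 𝒜) (hseq : ∀ B ∈ ℬ, IsSeqCompact B) :
    (largeCoverGame 𝒜 ℬ).LeTwo (closedDiscreteGame 𝒜 ℬ) := by
  classical
  have hchoice : ∀ U : ↥(properOpens (topology 𝒜)), ∃ Φ : MU X, ∃ A ∈ 𝒜, ∃ ε > 0,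
      {Ψ | (Φ, Ψ) ∈ entourage A ε} ⊆ (U : Set (MU X)) := by
    rintro ⟨U, hU⟩
    let _ := topology 𝒜
    have : Nonempty X := nonempty_of_properOpens ⟨U, hU⟩
    obtain ⟨Φ, hΦ⟩ := hU.2.1
    obtain ⟨⟨A, ε⟩, ⟨hA, hε⟩, hsub⟩ :=
      (hasBasis_nhds h𝒜 Φ).mem_iff.1 (hU.1.mem_nhds hΦ)
    exact ⟨Φ, A, hA, ε, hε, hsub⟩
  choose Φ A hA ε hε hsub using hchoice
  have hfun : ∀ (n : ℕ) (U : ↥(properOpens (topology 𝒜))) (V : Set X), ∃ Ψ : MU X,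
      V ∈ openSupersets (A U) → EqOn Ψ.1 (Φ U).1 (A U) ∧ ∀ x ∉ V, Ψ.1 x = {(n : ℝ)} := by
    intro n U V
    by_cases hV : V ∈ openSupersets (A U)
    · obtain ⟨Ψ, hΨ⟩ := exists_MU_eqOn hnormal (Φ U) (hA U) hV.1.1 hV.2 n
      exact ⟨Ψ, fun _ => hΨ⟩
    · exact ⟨zero X, fun h => absurd h hV⟩
  choose Ψ hΨ using hfun
  refine SelectionGame.IsTranslation.leTwo (G := largeCoverGame 𝒜 ℬ)
    (H := closedDiscreteGame 𝒜 ℬ) (f := fun _ U => ⟨openSupersets (A U), A U, hA U, rfl⟩)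
    (g := Ψ) ⟨fun n U V hV => hsub U fun x hx => ?_, fun U V hV hwin => ?_⟩
    (fun hne => ?_) (fun U hU => hU.2.1)
  · rw [(hΨ n U V hV).1 hx]
    exact ⟨Metric.self_subset_thickening (hε U) _, Metric.self_subset_thickening (hε U) _⟩
  · have : Nonempty X := nonempty_of_properOpens ⟨_, (U 0).2⟩
    obtain ⟨B, hB, hBV⟩ := hℬ.exists_not_subset_of_notMem_largeIdealCovers
      (by rintro _ ⟨n, rfl⟩; exact (hV n).1) hwin
    exact closedDiscrete_range_of_not_subset hℬ hB (hseq B hB)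
      (fun n => hBV _ (mem_range_self n)) fun n => (hΨ n (U n) (V n) (hV n)).2
  · have : Nonempty X := h𝒜.nonempty_of_openSupersetsFamily hne
    exact properOpens_topology_nonempty h𝒜

/-- Points are closed, and `𝟎` is not isolated because small nonzero constants approach it. -/
theorem diff_zero_mem_properOpens (h𝒜 : IsClosedIdeal 𝒜) {U : Set (MU X)}
    (hU : U ∈ properOpens (topology 𝒜)) : U \ {zero X} ∈ properOpens (topology 𝒜) := by
  let _ := topology 𝒜
  have : Nonempty X := nonempty_of_properOpens ⟨U, hU⟩
  have : T1Space (MU X) := t1Space h𝒜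
  refine ⟨hU.1.sdiff isClosed_singleton, ?_, fun hu => ?_⟩
  · obtain ⟨Φ, hΦ⟩ := hU.2.1
    by_cases h : Φ = zero X
    · subst h
      obtain ⟨⟨A, ε⟩, ⟨hA, hε⟩, hsub⟩ := (hasBasis_nhds h𝒜 _).mem_iff.1 (hU.1.mem_nhds hΦ)
      refine ⟨MU.const X (ε / 2), hsub (const_mem_entourage_zero ?_), fun h => ?_⟩
      · rw [abs_of_pos (half_pos hε)]
        exact half_lt_self hε
      · have h₁ : (MU.const X (ε / 2)).1 (Classical.arbitrary X) =
            (zero X).1 (Classical.arbitrary X) := by rw [mem_singleton_iff.1 h]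
        have h₂ : ε / 2 = 0 := singleton_eq_singleton_iff.1 h₁
        have h₃ : 0 < ε := hε
        linarith
    · exact ⟨Φ, hΦ, h⟩
  · have : zero X ∈ U \ {zero X} := hu ▸ mem_univ _
    exact this.2 rfl

theorem closedDiscreteGame_leTwo_opensZeroGame (h𝒜 : IsClosedIdeal 𝒜) :
    (closedDiscreteGame 𝒜 ℬ).LeTwo (opensZeroGame 𝒜 ℬ) := by
  refine SelectionGame.IsTranslation.leTwo (G := closedDiscreteGame 𝒜 ℬ)
    (H := opensZeroGame 𝒜 ℬ) (f := fun _ U => ⟨_, diff_zero_mem_properOpens h𝒜 U.2⟩)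
    (g := fun _ _ Φ => Φ) ⟨fun _ _ _ h => h.1, fun U Φ hΦ hwin hcl => ?_⟩ id
    (fun U hU => hU.2.1)
  have hcl' : zero X ∈ @closure _ (topology ℬ) (range Φ) := hcl
  rw [@IsClosed.closure_eq _ (topology ℬ) _ hwin.1] at hcl'
  obtain ⟨n, hn⟩ := hcl'
  exact (hΦ n).2 hn

theorem opensZeroGame_leTwo_nhdsZeroGame (h𝒜 : IsClosedIdeal 𝒜) :
    (opensZeroGame 𝒜 ℬ).LeTwo (nhdsZeroGame 𝒜 ℬ) := by
  refine SelectionGame.IsTranslation.leTwo (G := opensZeroGame 𝒜 ℬ) (H := nhdsZeroGame 𝒜 ℬ)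
    (f := fun _ U => ⟨U, U.2.1⟩) (g := fun _ _ Φ => Φ)
    ⟨fun _ _ _ h => h, fun _ _ _ h => h⟩ (fun hne => ?_) (fun U hU => hU.1.2.1)
  have : Nonempty X := nonempty_of_properOpens hne
  exact properNhds_zero_nonempty h𝒜

/-- If `Φ` is `ε`-close to zero on `A`, it is so on a proper open superset of `A`. -/
theorem exists_openSupersets_entourage_zero (h𝒜 : IsClosedIdeal 𝒜) {A : Set X} (hA : A ∈ 𝒜)
    {ε : ℝ} {Φ : MU X} (hΦ : Φ ∈ zeroNhd 𝒜 A ε) :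
    ∃ V ∈ openSupersets A, (zero X, Φ) ∈ entourage V ε := by
  let U : Set X := {x | Φ.1 x ⊆ Metric.ball 0 ε}
  have hU : IsOpen U := isOpen_iff_mem_nhds.2 fun x hx =>
    Φ.2.prop.eventually_subset Metric.isOpen_ball hx
  have hAU : A ⊆ U := fun x hx => subset_ball_of_mem_entourage_zero (mem_entourage_of_mem_zeroNhd hΦ) hx
  -- `U` may be all of `X`; intersecting with `W` makes it proper.
  obtain ⟨W, hW, hAW⟩ := h𝒜.openSupersets_nonempty hA
  have hAUW : A ⊆ U ∩ W := subset_inter hAU hAW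
  exact ⟨U ∩ W, ⟨⟨hU.inter hW.1, (h𝒜.nonempty A hA).mono hAUW, fun h =>
    hW.2.2 (univ_subset_iff.1 (h ▸ inter_subset_right))⟩, hAUW⟩,
    mem_entourage_zero fun x hx => hx.1⟩

theorem nhdsZeroGame_leTwo_coverGame (h𝒜 : IsClosedIdeal 𝒜) (hℬ : IsClosedIdeal ℬ) :
    (nhdsZeroGame 𝒜 ℬ).LeTwo (coverGame 𝒜 ℬ) := by
  classical
  have hchoice : ∀ N : ↥(openSupersetsFamily 𝒜), ∃ A ∈ 𝒜, openSupersets A = N := fun N => N.2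
  choose A hA hAN using hchoice
  let ε : ℕ → ℝ := fun n => 1 / (n + 1)
  have hε : ∀ n, 0 < ε n := fun n => Nat.one_div_pos_of_nat
  have hset : ∀ (n : ℕ) (N : ↥(openSupersetsFamily 𝒜)) (Φ : MU X), ∃ V : Set X,
      Φ ∈ zeroNhd 𝒜 (A N) (ε n) → V ∈ openSupersets (A N) ∧
        ∀ B ⊆ V, (zero X, Φ) ∈ entourage B (ε n) := by
    intro n N Φ
    by_cases hΦ : Φ ∈ zeroNhd 𝒜 (A N) (ε n)
    · obtain ⟨V, hV, hVΦ⟩ := exists_openSupersets_entourage_zero h𝒜 (hA N) hΦ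
      exact ⟨V, fun _ => ⟨hV, fun B hB => entourage_mono hB le_rfl hVΦ⟩⟩
    · exact ⟨∅, fun h => absurd h hΦ⟩
  choose V hV using hset
  refine SelectionGame.IsTranslation.leTwo (G := nhdsZeroGame 𝒜 ℬ) (H := coverGame 𝒜 ℬ)
    (f := fun n N => ⟨_, zeroNhd_mem_properNhds h𝒜 (hA N) (hε n)⟩) (g := V)
    ⟨fun n N Φ hΦ => hAN N ▸ (hV n N Φ hΦ).1, fun N Φ hΦ hwin => ?_⟩ (fun hne => ?_)
    (openSupersetsFamily_member_nonempty h𝒜)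
  · have : Nonempty X := (h𝒜.nonempty _ (hA (N 0))).to_type
    have hVp : ∀ n, V n (N n) (Φ n) ∈ properOpens ‹TopologicalSpace X› :=
      fun n => (hV n (N n) (Φ n) (hΦ n)).1.1
    refine (hℬ.notMem_idealCovers_iff (by rintro _ ⟨n, rfl⟩; exact hVp n)).2 ?_
    have hcl : zero X ∉ @closure _ (topology ℬ) (range Φ) := hwin
    let _ := topology ℬ
    rw [mem_closure_iff_nhds_basis (hasBasis_nhds hℬ (zero X))] at hcl
    push Not at hcl
    obtain ⟨⟨B, δ⟩, ⟨hB, hδ⟩, hfar⟩ := hcl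
    -- From round `k` on, `B ⊆ V` would put the answer in `W(B, δ)[𝟎]`; the rounds before `k` are
    -- handled by enlarging `B`.
    obtain ⟨k, hk⟩ := exists_nat_one_div_lt hδ
    obtain ⟨B', hB', hBB', hesc⟩ := hℬ.exists_superset_not_subset hB
      ((finite_Iio k).image fun n => V n (N n) (Φ n))
      (by rintro _ ⟨n, -, rfl⟩; exact (hVp n).2.2)
    refine ⟨B', hB', ?_⟩
    rintro _ ⟨n, rfl⟩ hsub
    rcases lt_or_ge n k with hn | hn
    · exact hesc _ ⟨n, hn, rfl⟩ hsub
    · refine hfar (Φ n) (mem_range_self n) (entourage_mono Subset.rfl ?_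
        ((hV n (N n) (Φ n) (hΦ n)).2 B (hBB'.trans hsub)))
      exact (Nat.one_div_le_one_div hn).trans hk.le
  · have : Nonempty X := nonempty_of_properOpens (hne.mono fun _ h => h.1)
    exact h𝒜.openSupersetsFamily_nonempty

end Games

theorem theorem3p5 {X : Type*} [TopologicalSpace X] (𝒜 ℬ : Set (Set X))
    (h𝒜 : IsClosedIdeal 𝒜) (hℬ : IsClosedIdeal ℬ) (hnormal : IsNormalFor 𝒜)
    (hseq : ∀ B ∈ ℬ, IsSeqCompact B) :
    SelectionGame.LeTwo
        ⟨openSupersetsFamily 𝒜, (largeIdealCovers ℬ)ᶜ⟩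
        ⟨properOpens (MU.topology 𝒜), closedDiscrete (MU.topology ℬ)⟩ ∧
      SelectionGame.Equivalent
        ⟨openSupersetsFamily 𝒜, (idealCovers ℬ)ᶜ⟩
        ⟨properNhds (MU.topology 𝒜) (MU.zero X), (clusterSets (MU.topology ℬ) (MU.zero X))ᶜ⟩ ∧
      SelectionGame.Equivalent
        ⟨properNhds (MU.topology 𝒜) (MU.zero X), (clusterSets (MU.topology ℬ) (MU.zero X))ᶜ⟩
        ⟨properOpens (MU.topology 𝒜), (clusterSets (MU.topology ℬ) (MU.zero X))ᶜ⟩ ∧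
      SelectionGame.Equivalent
        ⟨properOpens (MU.topology 𝒜), (clusterSets (MU.topology ℬ) (MU.zero X))ᶜ⟩
        ⟨properOpens (MU.topology 𝒜), closedDiscrete (MU.topology ℬ)⟩ := by
  have h₁ := coverGame_leTwo_largeCoverGame (ℬ := ℬ) h𝒜
  have h₂ := largeCoverGame_leTwo_closedDiscreteGame h𝒜 hℬ hnormal hseq
  have h₃ := closedDiscreteGame_leTwo_opensZeroGame (ℬ := ℬ) h𝒜
  have h₄ := opensZeroGame_leTwo_nhdsZeroGame (ℬ := ℬ) h𝒜
  have h₅ := nhdsZeroGame_leTwo_coverGame h𝒜 hℬ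
  have h₁₂ := h₁.trans h₂
  exact ⟨h₂, (h₁₂.trans (h₃.trans h₄)).antisymm h₅, (h₅.trans (h₁₂.trans h₃)).antisymm h₄,
    (h₄.trans (h₅.trans h₁₂)).antisymm h₃⟩
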